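/- Let $m\ge 1$ and let $\ell$ be an odd prime such that $3$ is a primitive root modulo $2\ell^m$. Put $q=3^{\phi(2\ell^m)}$, let $g$ be a primitive element of $\mathbb F_q$, and let $\mathrm{Tr}$ be the trace from $\mathbb F_q$ to $\mathbb F_3$. For $\alpha\in\mathbb F_3$ and $\beta\in\mathbb F_q$ let $$D=\{x\in\mathbb F_q^*:\ \mathrm{Tr}(x^{\frac{q-1}{2\ell^m}}+\beta x)=\alpha\}=\{d_1,\dots,d_n\},\qquad n=\#D,$$ $$\mathcal C_{\alpha,\beta}=\{(\mathrm{Tr}(d_1x),\dots,\mathrm{Tr}(d_nx)):\ x\in\mathbb F_q\}\subseteq\mathbb F_3^n,$$ and let $\mathcal C_{\alpha,\beta}^{\perp}$ be the dual code with respect to the Euclidean inner product on $\mathbb F_3^n$. For $\beta\ne0$ let $j_\beta\in\{0,\dots,2\ell^m-1\}$ be the least nonnegative residue of $-\mathrm{Ind}(\beta)$ modulo $2\ell^m$, where $\mathrm{Ind}(\beta)$ is the least $k\ge0$ with $g^k=\beta$. Let $J''=J_1^{(1)}\cup(J_2\setminus\{\ell^m\})\cup J_3^{(1)}\cup J_4$,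 where - $J_1^{(1)}=\{j\in\mathbb Z:1\le j\le(\ell-1)\ell^{m-1},\ \ell^{m-1}\nmid j\}$, - $J_2=\{j\in\mathbb Z:(\ell-1)\ell^{m-1}<j\le\ell^m\}$, - $J_3^{(1)}=\{\ell^m+k\ell^{m-1}-u:\ 1\le k\le\ell-1,\ 0<u\le\ell^{m-1}-1\}$, - $J_4=\{j\in\mathbb Z:2\ell^m-\ell^{m-1}<j\le2\ell^m-1\}$. Assume that we are not in the case $\ell\equiv-1\pmod 3$, $m=1$, $\alpha=\beta=0$ (in which $D=\emptyset$). Then $n\ge\ell^{m-1}(\ell-1)$, and $\mathcal C_{\alpha,\beta}^{\perp}$ is an $[n,\,n-\ell^{m-1}(\ell-1),\,2]$ code (length, dimension, minimum Hamming distance), with one exceptional case: if $\ell\equiv-1\pmod3$, $m=1$, $\alpha=0$ and $\beta\ne0$ with $j_\beta\notin J''$, then $\mathcal C_{\alpha,\beta}^{\perp}$ is an $[n,\,n-\ell^{m-1}(\ell-1),\,d]$ code with $d\ge3$. -/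

import Mathlib

namespace TernaryCode

noncomputable section

/-- The defining set `D = {x ∈ F^* : Tr(x^((q-1)/(2ℓ^m)) + βx) = α}`, where `q = #F` and `Tr` is
the absolute trace from `F` to `𝔽₃`. -/
def definingSet (F : Type*) [Field F] [Algebra (ZMod 3) F] (ℓ m : ℕ) (α : ZMod 3) (β : F) :
    Set F :=
  {x : F | x ≠ 0 ∧
    Algebra.trace (ZMod 3) F (x ^ ((Nat.card F - 1) / (2 * ℓ ^ m)) + β * x) = α}

/-- The `𝔽₃`-linear map `x ↦ (Tr(d₁ x), …, Tr(dₙ x))`. -/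
def traceMap {F : Type*} [Field F] [Algebra (ZMod 3) F] {n : ℕ} (d : Fin n → F) :
    F →ₗ[ZMod 3] (Fin n → ZMod 3) where
  toFun x := fun i => Algebra.trace (ZMod 3) F (d i * x)
  map_add' x y := by
    funext i
    simp [mul_add]
  map_smul' c x := by
    funext i
    simp

/-- The code `{(Tr(d₁ x), …, Tr(dₙ x)) : x ∈ F}`. -/
def traceCode {F : Type*} [Field F] [Algebra (ZMod 3) F] {n : ℕ} (d : Fin n → F) :
    Submodule (ZMod 3) (Fin n → ZMod 3) :=
  LinearMap.range (traceMap d)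

/-- The dual code with respect to the Euclidean inner product. -/
def dualCode {n : ℕ} (C : Submodule (ZMod 3) (Fin n → ZMod 3)) :
    Submodule (ZMod 3) (Fin n → ZMod 3) where
  carrier := {x | ∀ c ∈ C, ∑ i, x i * c i = 0}
  zero_mem' := by
    intro c _
    simp
  add_mem' := by
    intro x y hx hy c hc
    simp [add_mul, Finset.sum_add_distrib, hx c hc, hy c hc]
  smul_mem' := by
    intro a x hx c hc
    simp [mul_assoc, ← Finset.mul_sum, hx c hc]

/-- `C ⊆ 𝔽₃ⁿ` is an `[n, k, d]` code: it has dimension `k` and minimum distance `d`.  For a linear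
code the minimum distance is the least Hamming weight of a nonzero codeword; in particular `C` has
a nonzero codeword. -/
def HasParameters {n : ℕ} (C : Submodule (ZMod 3) (Fin n → ZMod 3)) (k d : ℕ) : Prop :=
  Module.finrank (ZMod 3) C = k ∧ IsLeast {w : ℕ | ∃ c ∈ C, c ≠ 0 ∧ hammingNorm c = w} d

/-- The index of `β ≠ 0` with respect to the primitive element `g`: the least `k ≥ 0` with
`g ^ k = β`. -/
def ind {F : Type*} [Field F] (g : Fˣ) (β : F) : ℕ :=
  sInf {k : ℕ | (g : F) ^ k = β}

/-- `j_β`, the least nonnegative residue of `-Ind(β)` modulo `2ℓ^m`. -/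
def jIndex {F : Type*} [Field F] (g : Fˣ) (ℓ m : ℕ) (β : F) : ℕ :=
  ((-(ind g β : ℤ)) % ((2 * ℓ ^ m : ℕ) : ℤ)).toNat

/-- `J₁⁽¹⁾`. -/
def setJ11 (ℓ m : ℕ) : Set ℕ :=
  {j | 1 ≤ j ∧ j ≤ (ℓ - 1) * ℓ ^ (m - 1) ∧ ¬ ℓ ^ (m - 1) ∣ j}

/-- `J₂`. -/
def setJ2 (ℓ m : ℕ) : Set ℕ :=
  {j | (ℓ - 1) * ℓ ^ (m - 1) < j ∧ j ≤ ℓ ^ m}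

/-- `J₃⁽¹⁾`. -/
def setJ31 (ℓ m : ℕ) : Set ℕ :=
  {j | ∃ k u : ℕ, 1 ≤ k ∧ k ≤ ℓ - 1 ∧ 0 < u ∧ u ≤ ℓ ^ (m - 1) - 1 ∧
    j = ℓ ^ m + k * ℓ ^ (m - 1) - u}

/-- `J₄`. -/
def setJ4 (ℓ m : ℕ) : Set ℕ :=
  {j | 2 * ℓ ^ m - ℓ ^ (m - 1) < j ∧ j ≤ 2 * ℓ ^ m - 1}

/-- `J'' = J₁⁽¹⁾ ∪ (J₂ \ {ℓ^m}) ∪ J₃⁽¹⁾ ∪ J₄`. -/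
def setJ'' (ℓ m : ℕ) : Set ℕ :=
  setJ11 ℓ m ∪ (setJ2 ℓ m \ {ℓ ^ m}) ∪ setJ31 ℓ m ∪ setJ4 ℓ m

/-- The exceptional case: `ℓ ≡ -1 (mod 3)`, `m = 1`, `α = 0`, and `β ≠ 0` with `j_β ∉ J''`. -/
def Exceptional {F : Type*} [Field F] (g : Fˣ) (ℓ m : ℕ) (α : ZMod 3) (β : F) : Prop :=
  (ℓ : ℤ) ≡ -1 [ZMOD 3] ∧ m = 1 ∧ α = 0 ∧ β ≠ 0 ∧ jIndex g ℓ m β ∉ setJ'' ℓ m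

end

end TernaryCode

/-! Put `N = 2ℓ^m`, `q = 3^(2h)` with `2h = φ(N)`, `M = (q-1)/N`. Since `3^h ≡ -1` modulo `N`, `M`
is a multiple of `3^h - 1`, so `x ↦ x^M` is constant on each punctured line `aK^*`, where `K` is the
subfield of order `3^h` and `F` is a plane over `K`. On such a line the condition defining `D` is
affine: `Tr(a^M) + f(k) = α`, with `f(k) = Tr(βak)` linear over `𝔽₃`. The values `a^M` are the
`N`-th roots of unity, and different values belong to different lines.

Dual codewords are the linear relations between the `dᵢ`, so the dimension claim says that `D` spans
`F`; for this, two lines inside the span suffice (`eq_top_of_lines`). As `0 ∉ D`, the distance is at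
least `2`, with equality exactly when some `x` and `-x` both lie in `D`, that is, `Tr(x^M) = α` and
`Tr(βx) = 0`. Because `dim K ≥ 2`, every line with `Tr(a^M) = α` contains such an `x`
(`exists_mem_neg_mem`).

What remains is which values are traces of `N`-th roots of unity. Nonzero values always occur at
least three times; `0` occurs unless `m = 1` and `ℓ ≡ -1 (mod 3)`. In the exceptional case no pair
`±x` exists, and a zero-sum triple gives distance exactly `3`. -/

namespace TernaryCode

/-! ### Arithmetic of the primitive root `3`. -/

theorem coprime_of_orderOf_ne_zero {a N : ℕ} (h : orderOf (a : ZMod N) ≠ 0) : a.Coprime N :=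
  (ZMod.isUnit_iff_coprime a N).1 (orderOf_pos_iff.1 (Nat.pos_of_ne_zero h)).isUnit

theorem exists_pow_eq_unit {N : ℕ} [NeZero N] {a : ℕ}
    (h : orderOf (a : ZMod N) = Nat.totient N) (u : (ZMod N)ˣ) :
    ∃ k : ℕ, (a : ZMod N) ^ k = u := by
  have hcop : a.Coprime N := coprime_of_orderOf_ne_zero
    (h ▸ (Nat.totient_pos.2 (Nat.pos_of_ne_zero (NeZero.ne N))).ne')
  set U := ZMod.unitOfCoprime a hcop
  have hU : (U : ZMod N) = a := ZMod.coe_unitOfCoprime a hcop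
  have hord : orderOf U = Nat.card (ZMod N)ˣ := by
    rw [← orderOf_units, hU, h, Nat.card_eq_fintype_card, ZMod.card_units_eq_totient]
  have hmem : u ∈ Subgroup.zpowers U := by
    rw [Subgroup.eq_top_of_card_eq (Subgroup.zpowers U) (by rw [Nat.card_zpowers, hord])]
    trivial
  obtain ⟨k, hk⟩ := mem_powers_iff_mem_zpowers.2 hmem
  exact ⟨k, by rw [← hk, ← hU]; simp⟩

/-- Units lift along `ZMod N → ZMod d`, so being a primitive root passes to divisors. It is used for
`d = ℓ` and `d = ℓ^m`. -/
theorem exists_pow_eq_unit_of_dvd {N d : ℕ} [NeZero N] (hd : d ∣ N) {a : ℕ}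
    (h : orderOf (a : ZMod N) = Nat.totient N) (u : (ZMod d)ˣ) :
    ∃ k : ℕ, (a : ZMod d) ^ k = u := by
  obtain ⟨v, rfl⟩ := ZMod.unitsMap_surjective hd u
  obtain ⟨k, hk⟩ := exists_pow_eq_unit h v
  refine ⟨k, ?_⟩
  have := congrArg (ZMod.castHom hd (ZMod d)) hk
  rw [map_pow, map_natCast] at this
  simpa [ZMod.unitsMap] using this

/-- A number all of whose powers exhaust the units modulo `d` has order `φ(d)`. -/
theorem orderOf_unitOfCoprime_eq_totient {d a : ℕ} [NeZero d] (ha : a.Coprime d)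
    (h : ∀ u : (ZMod d)ˣ, ∃ k : ℕ, (a : ZMod d) ^ k = u) :
    orderOf (ZMod.unitOfCoprime a ha) = Nat.totient d := by
  rw [orderOf_eq_card_of_forall_mem_zpowers (g := ZMod.unitOfCoprime a ha),
    Nat.card_eq_fintype_card, ZMod.card_units_eq_totient]
  intro u
  obtain ⟨k, hk⟩ := h u
  refine ⟨k, Units.ext ?_⟩
  simpa using hk

/-- If `3` is a primitive root modulo `2ℓ^m` then `3^(φ(2ℓ^m)/2) ≡ -1`. -/
theorem dvd_three_pow_half_add_one {ℓ m h : ℕ} (hℓ : ℓ.Prime) (hℓodd : Odd ℓ)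
    (hh : 0 < h) (hord : orderOf (3 : ZMod (2 * ℓ ^ m)) = 2 * h) : 2 * ℓ ^ m ∣ 3 ^ h + 1 := by
  have h2 : (2 * ℓ ^ m) ∣ 3 ^ (2 * h) - 1 := by
    rw [← ZMod.natCast_eq_zero_iff, Nat.cast_sub (Nat.one_le_pow _ _ (by norm_num))]
    have := pow_orderOf_eq_one (3 : ZMod (2 * ℓ ^ m))
    rw [hord] at this
    push_cast
    rw [this, sub_self]
  have hodd : Odd (3 ^ h) := Odd.pow (by decide)
  have hcop : Nat.Coprime 2 (ℓ ^ m) := (Nat.coprime_two_left.2 hℓodd).pow_right m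
  have hpos : 1 ≤ 3 ^ h := Nat.one_le_pow _ _ (by norm_num)
  have hfac : 3 ^ (2 * h) - 1 = (3 ^ h + 1) * (3 ^ h - 1) := by
    rw [mul_comm 2 h, pow_mul]
    have := Nat.sq_sub_sq (3 ^ h) 1
    simpa using this
  have hdiv : ℓ ^ m ∣ (3 ^ h + 1) * (3 ^ h - 1) := hfac ▸ (Dvd.intro_left 2 rfl).trans h2
  have hno : ¬ 2 * ℓ ^ m ∣ 3 ^ h - 1 := by
    intro hc
    rw [← ZMod.natCast_eq_zero_iff, Nat.cast_sub hpos] at hc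
    push_cast at hc
    have := orderOf_le_of_pow_eq_one hh (sub_eq_zero.1 hc)
    omega
  have hno' : ¬ ℓ ^ m ∣ 3 ^ h - 1 := fun hc =>
    hno (hcop.mul_dvd_of_dvd_of_dvd (hodd.tsub_odd (by decide)).two_dvd hc)
  refine hcop.mul_dvd_of_dvd_of_dvd (hodd.add_odd (by decide)).two_dvd ?_
  -- The two factors differ by `2`, so the odd prime `ℓ` divides at most one of them, and that one
  -- absorbs all of `ℓ^m`.
  by_cases hl : ℓ ∣ 3 ^ h - 1
  · have : ¬ ℓ ∣ 3 ^ h + 1 := by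
      intro hc
      have h2 : ℓ ∣ 2 := by
        have := Nat.dvd_sub hc hl
        rwa [show 3 ^ h + 1 - (3 ^ h - 1) = 2 by omega] at this
      have := (Nat.prime_dvd_prime_iff_eq hℓ Nat.prime_two).1 h2
      subst this
      exact absurd hℓodd (by decide)
    exact absurd (((hℓ.coprime_iff_not_dvd.2 this).pow_left m).dvd_of_dvd_mul_left hdiv) hno'
  · exact ((hℓ.coprime_iff_not_dvd.2 hl).pow_left m).dvd_of_dvd_mul_right hdiv

/-! ### Traces of roots of unity. -/

section Trace

variable {F : Type*} [Field F] [Algebra (ZMod 3) F]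

theorem trace_pow_three_pow [Finite F] (x : F) (k : ℕ) :
    Algebra.trace (ZMod 3) F (x ^ 3 ^ k) = Algebra.trace (ZMod 3) F x := by
  induction k with
  | zero => simp
  | succ k ih =>
    rw [← ih, pow_succ, pow_mul,
      ← Algebra.trace_eq_of_algEquiv (FiniteField.frobeniusAlgEquivOfAlgebraic (ZMod 3) F)
        (x ^ 3 ^ k)]
    simp

/-- `x^u` is a Frobenius conjugate of `x`, because `u` is a power of `3` modulo `d`. -/
theorem trace_pow_eq_of_coprime [Finite F] {d : ℕ}
    (h3 : ∀ u : (ZMod d)ˣ, ∃ k : ℕ, ((3 : ℕ) : ZMod d) ^ k = u) {x : F} (hx : x ^ d = 1)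
    {u : ℕ} (hu : u.Coprime d) :
    Algebra.trace (ZMod 3) F (x ^ u) = Algebra.trace (ZMod 3) F x := by
  obtain ⟨k, hk⟩ := h3 (ZMod.unitOfCoprime u hu)
  rw [ZMod.coe_unitOfCoprime, ← Nat.cast_pow, ZMod.natCast_eq_natCast_iff] at hk
  rw [← trace_pow_three_pow x k]
  congr 1
  exact pow_eq_pow_of_modEq hk.symm hx

/-- The trace of an element of prime order `ℓ`, when `3` is a primitive root modulo `ℓ`. -/
theorem trace_primitiveRoot_prime [Finite F] {ℓ c : ℕ} (hℓ : ℓ.Prime) (hcop : Nat.Coprime 3 ℓ)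
    (h3 : ∀ u : (ZMod ℓ)ˣ, ∃ k : ℕ, ((3 : ℕ) : ZMod ℓ) ^ k = u)
    (hfr : Module.finrank (ZMod 3) F = (ℓ - 1) * c) {w : F} (hw : IsPrimitiveRoot w ℓ) :
    Algebra.trace (ZMod 3) F w = -(c : ZMod 3) := by
  have : Fact ℓ.Prime := ⟨hℓ⟩
  have : Fact (Nat.Prime 3) := ⟨Nat.prime_three⟩
  have hnd : ¬ 3 ∣ ℓ := (Nat.prime_three.coprime_iff_not_dvd).1 hcop
  have : NeZero ((ℓ : ℕ) : ZMod 3) := ⟨fun h => hnd ((ZMod.natCast_eq_zero_iff _ _).1 h)⟩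
  have hirr : Irreducible (Polynomial.cyclotomic ℓ (ZMod 3)) := by
    refine ZMod.irreducible_of_dvd_cyclotomic_of_natDegree hnd dvd_rfl ?_
    rw [Polynomial.natDegree_cyclotomic]
    exact (orderOf_unitOfCoprime_eq_totient _ h3).symm
  have hmin := hw.minpoly_eq_cyclotomic_of_irreducible hirr
  have hdeg : (minpoly (ZMod 3) w).natDegree = ℓ - 1 := by
    rw [← hmin, Polynomial.natDegree_cyclotomic, Nat.totient_prime hℓ]
  have h2 := hℓ.two_le
  have hfin : Module.finrank (IntermediateField.adjoin (ZMod 3) {w}) F = c := by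
    have := Module.finrank_mul_finrank (ZMod 3) (IntermediateField.adjoin (ZMod 3) {w}) F
    rw [IntermediateField.adjoin.finrank (IsIntegral.of_finite _ _), hdeg, hfr] at this
    exact Nat.eq_of_mul_eq_mul_left (by omega) this
  -- The minimal polynomial is `1 + X + ⋯ + X^(ℓ-1)`.
  have hnext : (minpoly (ZMod 3) w).nextCoeff = 1 := by
    rw [Polynomial.nextCoeff_of_natDegree_pos (by omega), hdeg, ← hmin,
      Polynomial.cyclotomic_prime]
    simp only [Polynomial.finsetSum_coeff, Polynomial.coeff_X_pow]
    rw [Finset.sum_ite_eq, if_pos (Finset.mem_range.2 (by omega))]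
  rw [trace_eq_finrank_mul_minpoly_nextCoeff, hfin, hnext]
  ring

/-- The trace of a primitive `ℓ^m`-th root of unity vanishes for `m ≥ 2`. -/
theorem trace_primitiveRoot_prime_pow [Finite F] {ℓ m : ℕ} (hℓ : ℓ.Prime)
    (hcop : Nat.Coprime 3 ℓ) (hm : 2 ≤ m)
    (h3 : ∀ u : (ZMod (ℓ ^ m))ˣ, ∃ k : ℕ, ((3 : ℕ) : ZMod (ℓ ^ m)) ^ k = u)
    {z : F} (hz : IsPrimitiveRoot z (ℓ ^ m)) :
    Algebra.trace (ZMod 3) F z = 0 := by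
  have hprim : IsPrimitiveRoot (z ^ ℓ ^ (m - 1)) ℓ :=
    hz.pow (pow_pos hℓ.pos m) (by rw [← pow_succ]; congr 1; omega)
  have hsum := congrArg (fun y => Algebra.trace (ZMod 3) F (z * y))
    (hprim.geom_sum_eq_zero hℓ.one_lt)
  -- The exponents `1 + ℓ^(m-1) k` are prime to `ℓ` because `m ≥ 2`, so all terms are conjugate to
  -- `z`; the vanishing sum then reads `ℓ · Tr z = 0`.
  have hterm : ∀ k ∈ Finset.range ℓ, Algebra.trace (ZMod 3) F (z * (z ^ ℓ ^ (m - 1)) ^ k) =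
      Algebra.trace (ZMod 3) F z := by
    intro k _
    rw [← pow_mul, ← pow_succ']
    refine trace_pow_eq_of_coprime h3 hz.pow_eq_one (Nat.Coprime.pow_right m ?_)
    have hdvd : ℓ ∣ ℓ ^ (m - 1) * k := (dvd_pow_self ℓ (by omega)).mul_right k
    obtain ⟨t, ht⟩ := hdvd
    rw [ht]
    simp
  simp only [Finset.mul_sum, map_sum, mul_zero, map_zero] at hsum
  rw [Finset.sum_congr rfl hterm, Finset.sum_const, Finset.card_range, nsmul_eq_mul] at hsum
  have : Fact (Nat.Prime 3) := ⟨Nat.prime_three⟩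
  refine (mul_eq_zero.1 hsum).resolve_left fun h => ?_
  exact (Nat.prime_three.coprime_iff_not_dvd).1 hcop ((ZMod.natCast_eq_zero_iff _ _).1 h)

end Trace

/-! ### Dual codewords as linear relations. -/

section Code

variable {F : Type*} [Field F] [Algebra (ZMod 3) F]

theorem exists_trace_mul_ne_zero [Finite F] {a : F} (ha : a ≠ 0) :
    ∃ b, Algebra.trace (ZMod 3) F (a * b) ≠ 0 := by
  have : Fact (Nat.Prime 3) := ⟨Nat.prime_three⟩
  by_contra! hc
  exact ha ((traceForm_nondegenerate (ZMod 3) F).1 a fun b => by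
    simpa [Algebra.traceForm_apply] using hc b)

variable {n : ℕ} (d : Fin n → F)

/-- The pairing with the codeword of `y` is `Tr((∑ xᵢ dᵢ) y)`, and the trace form is nondegenerate.
-/
theorem mem_dualCode_traceCode [Finite F] {x : Fin n → ZMod 3} :
    x ∈ dualCode (traceCode d) ↔ ∑ i, x i • d i = 0 := by
  have key : ∀ y : F, ∑ i, x i * traceMap d y i =
      Algebra.trace (ZMod 3) F ((∑ i, x i • d i) * y) := by
    intro y
    simp [traceMap, Finset.sum_mul, map_sum]
  constructor
  · intro hx
    by_contra hne
    obtain ⟨b, hb⟩ := exists_trace_mul_ne_zero hne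
    exact hb ((key b).symm.trans (hx _ ⟨b, rfl⟩))
  · rintro hx _ ⟨y, rfl⟩
    rw [key, hx, zero_mul, map_zero]

theorem finrank_add_finrank_dualCode [Finite F]
    (hspan : Submodule.span (ZMod 3) (Set.range d) = ⊤) :
    Module.finrank (ZMod 3) F + Module.finrank (ZMod 3) (dualCode (traceCode d)) = n := by
  have : Fact (Nat.Prime 3) := ⟨Nat.prime_three⟩
  have hker : dualCode (traceCode d) = LinearMap.ker (Fintype.linearCombination (ZMod 3) d) := by
    ext x
    rw [mem_dualCode_traceCode, LinearMap.mem_ker, Fintype.linearCombination_apply]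
  have h := LinearMap.finrank_range_add_finrank_ker (Fintype.linearCombination (ZMod 3) d)
  rw [Fintype.range_linearCombination, hspan, finrank_top, ← hker] at h
  simpa using h

theorem ternary_eq_one_or {c : ZMod 3} (hc : c ≠ 0) : c = 1 ∨ c = -1 := by
  revert c
  decide

variable {d}

theorem two_le_hammingNorm [Finite F] (h0 : ∀ i, d i ≠ 0) {c : Fin n → ZMod 3}
    (hc : c ∈ dualCode (traceCode d)) (hne : c ≠ 0) : 2 ≤ hammingNorm c := by
  have : Fact (Nat.Prime 3) := ⟨Nat.prime_three⟩
  by_contra! hlt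
  have hpos := hammingNorm_pos_iff.2 hne
  obtain ⟨i, hi⟩ := Finset.card_eq_one.1 (show hammingNorm c = 1 by omega)
  rw [mem_dualCode_traceCode, Finset.sum_eq_single i] at hc
  · have : c i ≠ 0 := by
      have : i ∈ ({i} : Finset (Fin n)) := Finset.mem_singleton_self i
      rw [← hi] at this
      simpa using this
    exact (smul_ne_zero this (h0 i)) hc
  · intro j _ hj
    have : j ∉ ({i} : Finset (Fin n)) := by simpa using hj
    rw [← hi] at this
    have : c j = 0 := by simpa using this
    rw [this, zero_smul]
  · simp

theorem three_le_hammingNorm [Finite F] (h0 : ∀ i, d i ≠ 0) (hinj : Function.Injective d)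
    (hneg : ∀ i j, d j ≠ -d i) {c : Fin n → ZMod 3}
    (hc : c ∈ dualCode (traceCode d)) (hne : c ≠ 0) : 3 ≤ hammingNorm c := by
  by_contra! hlt
  have h2 := two_le_hammingNorm h0 hc hne
  obtain ⟨i, j, hij, hS⟩ := Finset.card_eq_two.1 (show hammingNorm c = 2 by omega)
  have hmem : ∀ k, c k ≠ 0 ↔ k = i ∨ k = j := by
    intro k
    have : k ∈ (Finset.univ.filter fun k => c k ≠ 0) ↔ k ∈ ({i, j} : Finset (Fin n)) := by
      rw [hS]
    simpa using this
  rw [mem_dualCode_traceCode, Finset.sum_eq_add i j hij] at hc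
  -- Both coefficients are `±1`, so a relation of weight two says `dⱼ = ±dᵢ`.
  · rcases ternary_eq_one_or ((hmem i).2 (Or.inl rfl)) with hi | hi <;>
      rcases ternary_eq_one_or ((hmem j).2 (Or.inr rfl)) with hj | hj <;>
      rw [hi, hj] at hc <;> simp only [one_smul, neg_smul] at hc
    · exact hneg i j (eq_neg_of_add_eq_zero_right hc)
    · exact hij (hinj (by linear_combination hc))
    · exact hij (hinj (by linear_combination -hc))
    · exact hneg i j (by linear_combination -hc)
  · rintro k - ⟨hk1, hk2⟩
    have : c k = 0 := by
      by_contra hk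
      rcases (hmem k).1 hk with h | h
      exacts [hk1 h, hk2 h]
    rw [this, zero_smul]
  · simp
  · simp

theorem exists_hammingNorm_eq_card [Finite F] (s : Finset (Fin n)) (hs : s.Nonempty)
    (hsum : ∑ i ∈ s, d i = 0) :
    ∃ c ∈ dualCode (traceCode d), c ≠ 0 ∧ hammingNorm c = s.card := by
  have hnorm : hammingNorm (fun i => if i ∈ s then (1 : ZMod 3) else 0) = s.card := by
    simp [hammingNorm]
  refine ⟨fun i => if i ∈ s then 1 else 0, ?_, ?_, hnorm⟩
  · rw [mem_dualCode_traceCode]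
    simpa [ite_smul, Finset.sum_ite_mem] using hsum
  · exact hammingNorm_pos_iff.1 (hnorm ▸ hs.card_pos)

end Code

/-! ### Lines over the subfield `K`. -/

section Lines

variable {F K : Type*} [Field F] [Field K] [Algebra (ZMod 3) F] [Algebra (ZMod 3) K]
  {s : K →ₐ[ZMod 3] F} {M : ℕ}

/-- If `aK` and `bK` coincided, `a^M` and `b^M` would agree. Hence the sum map `K × K → F` is
injective, and bijective by counting. -/
theorem exists_eq_mul_add_mul [Finite F] (hcard : Nat.card F = Nat.card K ^ 2)
    (hM : ∀ k, k ≠ 0 → s k ^ M = 1) {a b : F} (ha : a ≠ 0) (hb : b ≠ 0)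
    (hab : a ^ M ≠ b ^ M) (x : F) : ∃ k l, x = a * s k + b * s l := by
  have hinj : Function.Injective fun p : K × K => a * s p.1 + b * s p.2 := by
    rintro ⟨k, l⟩ ⟨k', l'⟩ h
    have h1 : a * s (k - k') = b * s (l' - l) := by
      simp only [map_sub]
      linear_combination h
    have hl : l' - l = 0 := by
      by_contra hl
      have hk : k - k' ≠ 0 := by
        intro hk
        rw [hk, map_zero, mul_zero] at h1
        exact mul_ne_zero hb ((map_ne_zero s).2 hl) h1.symm
      apply hab
      have := congrArg (· ^ M) h1
      simpa [mul_pow, -map_sub, hM _ hk, hM _ hl] using this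
    have hk : k - k' = 0 := by
      rw [hl, map_zero, mul_zero] at h1
      simpa [ha, -map_sub] using h1
    rw [Prod.mk.injEq]
    exact ⟨sub_eq_zero.1 hk, (sub_eq_zero.1 hl).symm⟩
  obtain ⟨⟨k, l⟩, h⟩ := (hinj.bijective_of_nat_card_le (by
    rw [hcard, Nat.card_prod, sq])).2 x
  exact ⟨k, l, h.symm⟩

theorem trace_mul_add_mul_pow (hM : ∀ k, k ≠ 0 → s k ^ M = 1) (β a : F) {k : K} (hk : k ≠ 0) :
    Algebra.trace (ZMod 3) F ((a * s k) ^ M + β * (a * s k)) =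
      Algebra.trace (ZMod 3) F (a ^ M) + Algebra.trace (ZMod 3) F (β * (a * s k)) := by
  rw [map_add, mul_pow, hM k hk, mul_one]

/-- The functional `k ↦ Tr(β a k)` on the subfield `K`. -/
noncomputable def lineFunctional (s : K →ₐ[ZMod 3] F) (β a : F) : K →ₗ[ZMod 3] ZMod 3 :=
  Algebra.trace (ZMod 3) F ∘ₗ LinearMap.mulLeft (ZMod 3) (β * a) ∘ₗ s.toLinearMap

theorem lineFunctional_apply (β a : F) (k : K) :
    lineFunctional s β a k = Algebra.trace (ZMod 3) F (β * (a * s k)) := by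
  simp [lineFunctional]

/-- Two different lines cannot both lie in the kernel of `x ↦ Tr(β x)`. -/
theorem lineFunctional_ne_zero_or [Finite F] (hcard : Nat.card F = Nat.card K ^ 2)
    (hM : ∀ k, k ≠ 0 → s k ^ M = 1) {β a b : F} (hβ : β ≠ 0) (ha : a ≠ 0) (hb : b ≠ 0)
    (hab : a ^ M ≠ b ^ M) : lineFunctional s β a ≠ 0 ∨ lineFunctional s β b ≠ 0 := by
  by_contra! hc
  obtain ⟨x, hx⟩ := exists_trace_mul_ne_zero hβ
  obtain ⟨k, l, rfl⟩ := exists_eq_mul_add_mul hcard hM ha hb hab x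
  apply hx
  rw [mul_add, map_add, ← lineFunctional_apply, ← lineFunctional_apply, hc.1, hc.2]
  simp

variable {W : Submodule (ZMod 3) F} {α : ZMod 3} {β : F}

/-- The points of `D` on this line form a fibre of the functional over a nonzero `c`. Scaling by
`𝔽₃^*` reaches every point outside the kernel, and a kernel point is a difference of two such
points. -/
theorem mul_mem_of_lineFunctional_ne_zero (hM : ∀ k, k ≠ 0 → s k ^ M = 1)
    (hW : ∀ x, x ≠ 0 → Algebra.trace (ZMod 3) F (x ^ M + β * x) = α → x ∈ W)
    {a : F} (ha : a ≠ 0) (hα : Algebra.trace (ZMod 3) F (a ^ M) ≠ α)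
    (hf : lineFunctional s β a ≠ 0) (k : K) : a * s k ∈ W := by
  have : Fact (Nat.Prime 3) := ⟨Nat.prime_three⟩
  set c := α - Algebra.trace (ZMod 3) F (a ^ M) with hc
  have hc0 : c ≠ 0 := sub_ne_zero.2 hα.symm
  have key : ∀ k, lineFunctional s β a k = c → a * s k ∈ W := by
    intro k hk
    have hk0 : k ≠ 0 := by
      rintro rfl
      exact hc0 (by rw [← hk, map_zero])
    refine hW _ (mul_ne_zero ha ((map_ne_zero s).2 hk0)) ?_
    rw [trace_mul_add_mul_pow hM β a hk0, ← lineFunctional_apply, hk, hc]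
    ring
  have key' : ∀ k, lineFunctional s β a k ≠ 0 → a * s k ∈ W := by
    intro k hk
    have h1 := key ((c * (lineFunctional s β a k)⁻¹) • k) (by simp [hk])
    rw [map_smul, mul_smul_comm] at h1
    exact (W.smul_mem_iff (mul_ne_zero hc0 (inv_ne_zero hk))).1 h1
  by_cases hk : lineFunctional s β a k = 0
  · obtain ⟨k₀, hk₀⟩ : ∃ k₀, lineFunctional s β a k₀ ≠ 0 := by
      by_contra! h
      exact hf (LinearMap.ext h)
    have h := W.sub_mem (key' (k + k₀) (by simpa [hk] using hk₀)) (key' k₀ hk₀)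
    rwa [← mul_sub, ← map_sub, add_sub_cancel_right] at h
  · exact key' k hk

theorem eq_top_of_lines [Finite F] (hcard : Nat.card F = Nat.card K ^ 2)
    (hM : ∀ k, k ≠ 0 → s k ^ M = 1) {a b : F} (ha : a ≠ 0) (hb : b ≠ 0)
    (hab : a ^ M ≠ b ^ M) (hWa : ∀ k, a * s k ∈ W) (hWb : ∀ k, b * s k ∈ W) : W = ⊤ := by
  refine Submodule.eq_top_iff'.2 fun x => ?_
  obtain ⟨k, l, rfl⟩ := exists_eq_mul_add_mul hcard hM ha hb hab x
  exact W.add_mem (hWa k) (hWb l)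

/-- For `β ≠ 0` the defining set spans as soon as some value other than `α` is the trace of
`x^M` on three different cosets. -/
theorem eq_top_of_ne_zero [Finite F] (hcard : Nat.card F = Nat.card K ^ 2)
    (hM : ∀ k, k ≠ 0 → s k ^ M = 1)
    (hW : ∀ x, x ≠ 0 → Algebra.trace (ZMod 3) F (x ^ M + β * x) = α → x ∈ W)
    (hβ : β ≠ 0) {a : Fin 3 → F} (ha : ∀ i, a i ≠ 0) (hinj : ∀ i j, i ≠ j → a i ^ M ≠ a j ^ M)
    (hα : ∀ i, Algebra.trace (ZMod 3) F (a i ^ M) ≠ α) : W = ⊤ := by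
  have hor := fun i j (hij : i ≠ j) =>
    lineFunctional_ne_zero_or hcard hM hβ (ha i) (ha j) (hinj i j hij)
  have hmain : ∀ i j, i ≠ j → lineFunctional s β (a i) ≠ 0 → lineFunctional s β (a j) ≠ 0 →
      W = ⊤ := fun i j hij hi hj =>
    eq_top_of_lines hcard hM (ha i) (ha j) (hinj i j hij)
      (mul_mem_of_lineFunctional_ne_zero hM hW (ha i) (hα i) hi)
      (mul_mem_of_lineFunctional_ne_zero hM hW (ha j) (hα j) hj)
  -- At most one of the three functionals vanishes, so two lines are always available.
  by_cases h0 : lineFunctional s β (a 0) = 0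
  · exact hmain 1 2 (by decide) ((hor 0 1 (by decide)).resolve_left (not_not.2 h0))
      ((hor 0 2 (by decide)).resolve_left (not_not.2 h0))
  · rcases hor 1 2 (by decide) with h | h
    exacts [hmain 0 1 (by decide) h0 h, hmain 0 2 (by decide) h0 h]

theorem eq_top_of_eq_zero [Finite F] (hcard : Nat.card F = Nat.card K ^ 2)
    (hM : ∀ k, k ≠ 0 → s k ^ M = 1)
    (hW : ∀ x, x ≠ 0 → Algebra.trace (ZMod 3) F (x ^ M + 0 * x) = α → x ∈ W)
    {a b : F} (ha : a ≠ 0) (hb : b ≠ 0) (hab : a ^ M ≠ b ^ M)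
    (haα : Algebra.trace (ZMod 3) F (a ^ M) = α) (hbα : Algebra.trace (ZMod 3) F (b ^ M) = α) :
    W = ⊤ := by
  have key : ∀ a : F, a ≠ 0 → Algebra.trace (ZMod 3) F (a ^ M) = α → ∀ k, a * s k ∈ W := by
    intro a ha h k
    by_cases hk : k = 0
    · simp [hk]
    · refine hW _ (mul_ne_zero ha ((map_ne_zero s).2 hk)) ?_
      rw [trace_mul_add_mul_pow hM 0 a hk, h]
      simp
  exact eq_top_of_lines hcard hM ha hb hab (key a ha haα) (key b hb hbα)

theorem exists_ne_zero_lineFunctional_eq_zero [Finite K] (hK : 2 ≤ Module.finrank (ZMod 3) K)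
    (β a : F) : ∃ k : K, k ≠ 0 ∧ lineFunctional s β a k = 0 := by
  have : Fact (Nat.Prime 3) := ⟨Nat.prime_three⟩
  have h : LinearMap.ker (lineFunctional s β a) ≠ ⊥ :=
    LinearMap.ker_ne_bot_of_finrank_lt (by rw [Module.finrank_self]; omega)
  obtain ⟨k, hk, hk0⟩ := Submodule.exists_mem_ne_zero_of_ne_bot h
  exact ⟨k, hk0, hk⟩

/-- A coset with `Tr(a^M) = α` contains `x` such that both `x` and `-x` lie in the defining
set. -/
theorem exists_mem_neg_mem [Finite K] (hK : 2 ≤ Module.finrank (ZMod 3) K)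
    (hM : ∀ k, k ≠ 0 → s k ^ M = 1) {a : F} (ha : a ≠ 0)
    (hα : Algebra.trace (ZMod 3) F (a ^ M) = α) (β : F) :
    ∃ x, x ≠ 0 ∧ Algebra.trace (ZMod 3) F (x ^ M + β * x) = α ∧
      Algebra.trace (ZMod 3) F ((-x) ^ M + β * (-x)) = α := by
  obtain ⟨k, hk, hk0⟩ := exists_ne_zero_lineFunctional_eq_zero (s := s) hK β a
  refine ⟨a * s k, mul_ne_zero ha ((map_ne_zero s).2 hk), ?_, ?_⟩
  · rw [trace_mul_add_mul_pow hM β a hk, ← lineFunctional_apply, hk0, hα, add_zero]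
  · rw [← mul_neg, ← map_neg, trace_mul_add_mul_pow hM β a (neg_ne_zero.2 hk),
      ← lineFunctional_apply, map_neg, hk0, hα, neg_zero, add_zero]

/-- A coset with `Tr(a^M) ≠ α` on whose line `x ↦ Tr(β x)` is not zero contains three different
elements of the defining set with sum `0`. -/
theorem exists_three_sum_eq_zero [Finite K] (hK : 2 ≤ Module.finrank (ZMod 3) K)
    (hM : ∀ k, k ≠ 0 → s k ^ M = 1) {a : F} (ha : a ≠ 0)
    (hα : Algebra.trace (ZMod 3) F (a ^ M) ≠ α) (hf : lineFunctional s β a ≠ 0) :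
    ∃ x : ZMod 3 → F, Function.Injective x ∧ ∑ i, x i = 0 ∧ ∀ i, x i ≠ 0 ∧
      Algebra.trace (ZMod 3) F (x i ^ M + β * x i) = α := by
  have : Fact (Nat.Prime 3) := ⟨Nat.prime_three⟩
  set c := α - Algebra.trace (ZMod 3) F (a ^ M) with hc
  have hc0 : c ≠ 0 := sub_ne_zero.2 hα.symm
  obtain ⟨k, hk, hk0⟩ := exists_ne_zero_lineFunctional_eq_zero (s := s) hK β a
  obtain ⟨k₀, hk₀⟩ : ∃ k₀, lineFunctional s β a k₀ = c := by
    obtain ⟨k₁, hk₁⟩ : ∃ k₁, lineFunctional s β a k₁ ≠ 0 := by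
      by_contra! h
      exact hf (LinearMap.ext h)
    exact ⟨(c * (lineFunctional s β a k₁)⁻¹) • k₁, by simp [hk₁]⟩
  have hval : ∀ t : ZMod 3, lineFunctional s β a (k₀ + t • k) = c := by
    intro t
    simp [hk0, hk₀]
  -- An affine `𝔽₃`-line in the direction of a kernel vector stays in the fibre over `c`, and its
  -- three points sum to `0` in characteristic `3`.
  refine ⟨fun t => a * s (k₀ + t • k), ?_, ?_, fun t => ?_⟩
  · intro t t' h
    have h1 := add_left_cancel (s.injective (mul_left_cancel₀ ha h))
    exact smul_left_injective _ hk h1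
  · have h3 : (3 : K) = 0 := by
      have := charP_of_injective_algebraMap (algebraMap (ZMod 3) K).injective 3
      exact_mod_cast CharP.cast_eq_zero K 3
    have hs : ∑ t : ZMod 3, t = 0 := rfl
    rw [← Finset.mul_sum, ← map_sum, Finset.sum_add_distrib, ← Finset.sum_smul, hs,
      Finset.sum_const, Finset.card_univ, ZMod.card, nsmul_eq_mul, Nat.cast_ofNat, h3]
    simp
  · have hne : k₀ + t • k ≠ 0 := by
      intro h
      apply hc0
      rw [← hval t, h, map_zero]
    refine ⟨mul_ne_zero ha ((map_ne_zero s).2 hne), ?_⟩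
    rw [trace_mul_add_mul_pow hM β a hne, ← lineFunctional_apply, hval t, hc]
    ring

end Lines

/-! ### Trace values attained on `2ℓ^m`-th roots of unity. -/

section Values

variable {F : Type*} [Field F] [Algebra (ZMod 3) F] {ℓ m : ℕ}

theorem totient_two_mul_prime_pow (hℓ : ℓ.Prime) (hℓodd : Odd ℓ) (hm : 1 ≤ m) :
    Nat.totient (2 * ℓ ^ m) = ℓ ^ (m - 1) * (ℓ - 1) := by
  rw [Nat.totient_mul ((Nat.coprime_two_left.2 hℓodd).pow_right m), Nat.totient_two, one_mul,
    Nat.totient_prime_pow hℓ hm]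

theorem five_le_of_coprime (hℓ : ℓ.Prime) (hℓodd : Odd ℓ) (h3 : Nat.Coprime 3 ℓ) : 5 ≤ ℓ := by
  by_contra! h
  have h2 := hℓ.two_le
  interval_cases ℓ <;> revert hℓodd h3 <;> decide

theorem finrank_eq_of_card [Finite F] {e : ℕ} (hF : Nat.card F = 3 ^ e) :
    Module.finrank (ZMod 3) F = e := by
  have : Fact (Nat.Prime 3) := ⟨Nat.prime_three⟩
  have h := FiniteField.pow_finrank_eq_natCard 3 F
  rw [hF] at h
  exact Nat.pow_right_injective (show 2 ≤ 3 by norm_num) h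

/-- Every nonzero value is the trace of three different `2ℓ^m`-th roots of unity. -/
theorem exists_three_trace_eq [Finite F] (hℓ : ℓ.Prime) (hm : 1 ≤ m)
    (hℓ5 : 5 ≤ ℓ) (hcop : Nat.Coprime 3 ℓ)
    (h3 : ∀ u : (ZMod ℓ)ˣ, ∃ k : ℕ, ((3 : ℕ) : ZMod ℓ) ^ k = u)
    (hfr : Module.finrank (ZMod 3) F = ℓ ^ (m - 1) * (ℓ - 1)) {z : F}
    (hz : IsPrimitiveRoot z (ℓ ^ m)) {c : ZMod 3} (hc : c ≠ 0) :
    ∃ y : Fin 3 → F, Function.Injective y ∧ (∀ i, y i ^ (2 * ℓ ^ m) = 1) ∧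
      ∀ i, Algebra.trace (ZMod 3) F (y i) = c := by
  have hw : IsPrimitiveRoot (z ^ ℓ ^ (m - 1)) ℓ :=
    hz.pow (pow_pos hℓ.pos m) (by rw [← pow_succ]; congr 1; omega)
  set w := z ^ ℓ ^ (m - 1)
  -- The exponents `1, 2, 3` are prime to `ℓ` and distinct modulo `ℓ`, as `ℓ ≥ 5`.
  have hwt : ∀ i : Fin 3, Algebra.trace (ZMod 3) F (w ^ (i.val + 1)) =
      -((ℓ ^ (m - 1) : ℕ) : ZMod 3) := by
    intro i
    refine trace_primitiveRoot_prime hℓ hcop h3 (by rw [hfr, mul_comm]) ?_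
    refine hw.pow_of_coprime _ ((hℓ.coprime_iff_not_dvd.2 fun h => ?_).symm)
    have := Nat.le_of_dvd (by omega) h
    omega
  have hwinj : Function.Injective fun i : Fin 3 => w ^ (i.val + 1) := by
    intro i j hij
    have := hw.pow_inj (by omega) (by omega) hij
    exact Fin.ext (by omega)
  have hwpow : ∀ i : Fin 3, (w ^ (i.val + 1)) ^ (2 * ℓ ^ m) = 1 := by
    intro i
    have : ℓ ∣ (i.val + 1) * (2 * ℓ ^ m) :=
      ((dvd_pow_self ℓ (by omega)).mul_left 2).mul_left _
    rw [← pow_mul]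
    exact (hw.pow_eq_one_iff_dvd _).2 this
  have hv : ((ℓ ^ (m - 1) : ℕ) : ZMod 3) ≠ 0 := fun h =>
    (Nat.prime_three.coprime_iff_not_dvd).1 (hcop.pow_right (m - 1))
      ((ZMod.natCast_eq_zero_iff _ _).1 h)
  have hcases : ∀ c v : ZMod 3, c ≠ 0 → v ≠ 0 → c = -v ∨ c = v := by decide
  -- The powers of `w` have trace `-v`; their negatives, still `2ℓ^m`-th roots of unity, supply the
  -- other nonzero value.
  rcases hcases _ _ hc hv with h | h
  · exact ⟨_, hwinj, hwpow, fun i => (hwt i).trans h.symm⟩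
  · refine ⟨fun i => -w ^ (i.val + 1), fun i j hij => hwinj (neg_injective hij), fun i => ?_,
      fun i => ?_⟩
    · rw [Even.neg_pow ⟨ℓ ^ m, two_mul _⟩, hwpow i]
    · rw [map_neg, hwt i, neg_neg, h]

theorem trace_one_eq_finrank [Finite F] :
    Algebra.trace (ZMod 3) F 1 = (Module.finrank (ZMod 3) F : ZMod 3) := by
  have : Fact (Nat.Prime 3) := ⟨Nat.prime_three⟩
  have := Algebra.trace_algebraMap (R := ZMod 3) (S := F) 1
  simpa using this

/-- Unless `m = 1` and `ℓ ≡ -1 (mod 3)`, the value `0` is the trace of two different `2ℓ^m`-th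
roots of unity. -/
theorem exists_two_trace_eq_zero [Finite F] (hℓ : ℓ.Prime) (hm : 1 ≤ m)
    (hcop : Nat.Coprime 3 ℓ) (hex : ¬ ((ℓ : ℤ) ≡ -1 [ZMOD 3] ∧ m = 1))
    (h3 : ∀ u : (ZMod (ℓ ^ m))ˣ, ∃ k : ℕ, ((3 : ℕ) : ZMod (ℓ ^ m)) ^ k = u)
    (hfr : Module.finrank (ZMod 3) F = ℓ ^ (m - 1) * (ℓ - 1)) {z : F}
    (hz : IsPrimitiveRoot z (ℓ ^ m)) :
    ∃ y y' : F, y ≠ y' ∧ y ^ (2 * ℓ ^ m) = 1 ∧ y' ^ (2 * ℓ ^ m) = 1 ∧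
      Algebra.trace (ZMod 3) F y = 0 ∧ Algebra.trace (ZMod 3) F y' = 0 := by
  have h20 : (2 : ZMod 3) ≠ 0 := by decide
  have hchar : (2 : F) ≠ 0 := by
    intro h
    have h2 : algebraMap (ZMod 3) F 2 = 0 := by rw [← h]; exact map_ofNat _ 2
    have : Fact (Nat.Prime 3) := ⟨Nat.prime_three⟩
    exact h20 ((map_eq_zero _).1 h2)
  obtain ⟨y, hy1, hy0⟩ : ∃ y : F, y ^ ℓ ^ m = 1 ∧ Algebra.trace (ZMod 3) F y = 0 := by
    by_cases hm2 : 2 ≤ m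
    · exact ⟨z, hz.pow_eq_one, trace_primitiveRoot_prime_pow hℓ hcop hm2 h3 hz⟩
    · obtain rfl : m = 1 := by omega
      -- Here `ℓ ≡ 1 (mod 3)`, so `Tr 1 = ℓ - 1 = 0`.
      refine ⟨1, one_pow _, ?_⟩
      rw [trace_one_eq_finrank, hfr, ZMod.natCast_eq_zero_iff]
      have hnd := (Nat.prime_three.coprime_iff_not_dvd).1 hcop
      simp only [Int.ModEq, and_true] at hex
      simp only [tsub_self, pow_zero, one_mul]
      omega
  have hyN : y ^ (2 * ℓ ^ m) = 1 := by rw [mul_comm, pow_mul, hy1, one_pow]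
  refine ⟨y, -y, fun h => ?_, hyN, ?_, hy0, by rw [map_neg, hy0, neg_zero]⟩
  · have : y = 0 := by
      have : (2 : F) * y = 0 := by linear_combination h
      exact (mul_eq_zero.1 this).resolve_left hchar
    rw [this, zero_pow (pow_pos hℓ.pos m).ne'] at hy1
    exact zero_ne_one hy1
  · rw [Even.neg_pow ⟨ℓ ^ m, two_mul _⟩, hyN]

/-- For `ℓ ≡ -1 (mod 3)` no `2ℓ`-th root of unity has trace `0`. -/
theorem trace_ne_zero_of_pow_eq_one [Finite F] (hℓ : ℓ.Prime) (hℓodd : Odd ℓ)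
    (hcop : Nat.Coprime 3 ℓ) (hmod : (ℓ : ℤ) ≡ -1 [ZMOD 3])
    (h3 : ∀ u : (ZMod ℓ)ˣ, ∃ k : ℕ, ((3 : ℕ) : ZMod ℓ) ^ k = u)
    (hfr : Module.finrank (ZMod 3) F = ℓ - 1) {y : F} (hy : y ^ (2 * ℓ) = 1) :
    Algebra.trace (ZMod 3) F y ≠ 0 := by
  have h10 : -((1 : ℕ) : ZMod 3) ≠ 0 := by decide
  have : Fact (Nat.Prime 3) := ⟨Nat.prime_three⟩
  have key : ∀ x : F, x ^ ℓ = 1 → Algebra.trace (ZMod 3) F x ≠ 0 := by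
    intro x hx
    by_cases hx1 : x = 1
    · rw [hx1, trace_one_eq_finrank, hfr, Ne, ZMod.natCast_eq_zero_iff]
      have := hℓ.two_le
      simp only [Int.ModEq] at hmod
      omega
    · have : Fact ℓ.Prime := ⟨hℓ⟩
      have hprim : IsPrimitiveRoot x ℓ := by
        rw [← orderOf_eq_prime hx hx1]
        exact IsPrimitiveRoot.orderOf x
      rw [trace_primitiveRoot_prime (c := 1) hℓ hcop h3 (by rw [hfr, mul_one]) hprim]
      exact h10
  have hsq : (y ^ ℓ) ^ 2 = 1 := by rw [← pow_mul, mul_comm, hy]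
  -- One of `y`, `-y` is an `ℓ`-th root of unity; these have trace `ℓ - 1 = 1` or `-1` in `𝔽₃`.
  rcases mul_self_eq_one_iff.1 ((sq _).symm.trans hsq) with h | h
  · exact key y h
  · have := key (-y) (by rw [hℓodd.neg_pow, h, neg_neg])
    simpa using this

/-- `J''` is empty for `m = 1`. -/
theorem setJ''_one (hℓ : 1 ≤ ℓ) : setJ'' ℓ 1 = ∅ := by
  refine Set.eq_empty_of_forall_notMem fun j hj => ?_
  simp only [setJ'', setJ11, setJ2, setJ31, setJ4, Set.mem_union, Set.mem_sdiff, Set.mem_ofPred_eq,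
    Set.mem_singleton_iff, pow_one, Nat.sub_self, pow_zero, one_dvd, not_true_eq_false, mul_one,
    and_false, false_or] at hj
  rcases hj with (⟨h1, h2⟩ | ⟨k, u, -, -, h1, h2, -⟩) | ⟨h1, h2⟩ <;> omega

end Values

/-! ### Powers in the cyclic group `F^*`, the subfield, and code parameters. -/

section Cyclic

variable {F : Type*} [Field F]

/-- In a finite field every `N`-th root of unity is a `(q-1)/N`-th power, for `N ∣ q - 1`. -/
theorem exists_pow_eq_of_pow_eq_one [Finite F] {g : Fˣ} (hg : ∀ u : Fˣ, u ∈ Subgroup.zpowers g)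
    {N M : ℕ} (hN : 0 < N) (hMN : Nat.card F - 1 = N * M) {y : F} (hy : y ^ N = 1) :
    ∃ a : F, a ≠ 0 ∧ a ^ M = y := by
  have hord : orderOf g = N * M := by
    rw [orderOf_eq_card_of_forall_mem_zpowers hg, Nat.card_units, hMN]
  have hy0 : y ≠ 0 := by
    rintro rfl
    rw [zero_pow hN.ne'] at hy
    exact zero_ne_one hy
  obtain ⟨k, hk⟩ := mem_powers_iff_mem_zpowers.2 (hg (Units.mk0 y hy0))
  simp only at hk
  have h1 : g ^ (k * N) = 1 := by
    rw [pow_mul, hk]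
    ext
    simpa using hy
  have hdvd : N * M ∣ N * k := by
    rw [← hord, mul_comm N k]
    exact orderOf_dvd_of_pow_eq_one h1
  obtain ⟨t, rfl⟩ := Nat.dvd_of_mul_dvd_mul_left hN hdvd
  refine ⟨(g ^ t : Fˣ), Units.ne_zero _, ?_⟩
  rw [← Units.val_pow_eq_pow_val, ← pow_mul, mul_comm t M, hk, Units.val_mk0]

theorem exists_isPrimitiveRoot [Finite F] {g : Fˣ} (hg : ∀ u : Fˣ, u ∈ Subgroup.zpowers g)
    {N : ℕ} (hN : N ∣ Nat.card F - 1) : ∃ z : F, IsPrimitiveRoot z N := by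
  obtain ⟨M, hM⟩ := hN
  have hord : orderOf g = N * M := by
    rw [orderOf_eq_card_of_forall_mem_zpowers hg, Nat.card_units, hM]
  have h := (IsPrimitiveRoot.orderOf g).pow (orderOf_pos g) (hord.trans (mul_comm N M))
  exact ⟨_, IsPrimitiveRoot.coe_units_iff.2 h⟩

end Cyclic

/-- The subfield with `3^h` elements of a field with `3^(2h)` elements. -/
theorem exists_algHom_galoisField {F : Type*} [Field F] [Finite F] [Algebra (ZMod 3) F]
    [Fact (Nat.Prime 3)] {h N M : ℕ} (hh : h ≠ 0) (hF : Nat.card F = 3 ^ (2 * h)) (hN : 0 < N)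
    (hdvd : N ∣ 3 ^ h + 1) (hMN : Nat.card F - 1 = N * M) :
    ∃ s : GaloisField 3 h →ₐ[ZMod 3] F, ∀ k, k ≠ 0 → s k ^ M = 1 := by
  obtain ⟨s⟩ := FiniteField.nonempty_algHom_of_finrank_dvd (F := ZMod 3) (K := GaloisField 3 h)
    (L := F) (by rw [GaloisField.finrank 3 hh, finrank_eq_of_card hF]; exact Dvd.intro_left 2 rfl)
  refine ⟨s, fun k hk => ?_⟩
  obtain ⟨t, ht⟩ := hdvd
  have hM : M = (3 ^ h - 1) * t := by
    refine Nat.eq_of_mul_eq_mul_left hN ?_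
    have hfac := Nat.sq_sub_sq (3 ^ h) 1
    rw [← hMN, hF, mul_left_comm, ← ht, mul_comm 2 h, pow_mul]
    simpa [mul_comm] using hfac
  have : Fintype (GaloisField 3 h) := Fintype.ofFinite _
  have hk1 : k ^ (3 ^ h - 1) = 1 := by
    rw [← GaloisField.card 3 h hh, Nat.card_eq_fintype_card]
    exact FiniteField.pow_card_sub_one_eq_one k hk
  rw [hM, ← map_pow, pow_mul, hk1, one_pow, map_one]

/-- A zero-sum set of `δ` points of `D` gives a `0/1` word of weight `δ`, so only the lower bound on
weights has to be supplied. -/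
theorem hasParameters_of_span_eq_top {F : Type*} [Field F] [Finite F] [Algebra (ZMod 3) F] {n : ℕ}
    {d : Fin n → F} (hspan : Submodule.span (ZMod 3) (Set.range d) = ⊤) {e δ : ℕ}
    (he : Module.finrank (ZMod 3) F = e)
    (hmin : ∀ c ∈ dualCode (traceCode d), c ≠ 0 → δ ≤ hammingNorm c) {t : Finset (Fin n)}
    (ht : t.Nonempty) (hsum : ∑ i ∈ t, d i = 0) (hcard : t.card = δ) :
    HasParameters (dualCode (traceCode d)) (n - e) δ := by
  have h := finrank_add_finrank_dualCode d hspan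
  refine ⟨by omega, ?_, ?_⟩
  · obtain ⟨c, hc, hc0, hcn⟩ := exists_hammingNorm_eq_card t ht hsum
    exact ⟨c, hc, hc0, hcn.trans hcard⟩
  · rintro w ⟨c, hc, hc0, rfl⟩
    exact hmin c hc hc0

theorem exists_ne_zero_and_ne (α : ZMod 3) : ∃ c : ZMod 3, c ≠ 0 ∧ c ≠ α := by
  revert α
  decide

theorem eq_zero_of_add_of_add_neg {u v : ZMod 3} (h : u + v = 0) (h' : u + -v = 0) : u = 0 := by
  revert u v
  decide

end TernaryCode

/-! ### The main theorem. -/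

open TernaryCode in
theorem theorem5p1 {F : Type*} [Field F] [Algebra (ZMod 3) F]
    (ℓ m : ℕ) (hℓ : ℓ.Prime) (hℓodd : Odd ℓ) (hm : 1 ≤ m)
    -- `3` is a primitive root modulo `2ℓ^m`
    (hroot : orderOf (3 : ZMod (2 * ℓ ^ m)) = Nat.totient (2 * ℓ ^ m))
    (hF : Nat.card F = 3 ^ Nat.totient (2 * ℓ ^ m))
    -- `g` is a primitive element of `F`
    (g : Fˣ) (hg : ∀ u : Fˣ, u ∈ Subgroup.zpowers g)
    (α : ZMod 3) (β : F)
    -- the one case in which the defining set, hence the length of the code, is empty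
    (hne : ¬ ((ℓ : ℤ) ≡ -1 [ZMOD 3] ∧ m = 1 ∧ α = 0 ∧ β = 0))
    -- an enumeration `d₁, …, dₙ` of the defining set
    (n : ℕ) (d : Fin n ≃ TernaryCode.definingSet F ℓ m α β) :
    ℓ ^ (m - 1) * (ℓ - 1) ≤ n ∧
    (TernaryCode.Exceptional g ℓ m α β →
      ∃ δ : ℕ, 3 ≤ δ ∧
        TernaryCode.HasParameters
          (TernaryCode.dualCode (TernaryCode.traceCode fun i => (d i : F)))
          (n - ℓ ^ (m - 1) * (ℓ - 1)) δ) ∧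
    (¬ TernaryCode.Exceptional g ℓ m α β →
      TernaryCode.HasParameters
        (TernaryCode.dualCode (TernaryCode.traceCode fun i => (d i : F)))
        (n - ℓ ^ (m - 1) * (ℓ - 1)) 2) := by
  have h3p : Fact (Nat.Prime 3) := ⟨Nat.prime_three⟩
  have hfinF : Finite F := Nat.finite_of_card_ne_zero (by rw [hF]; positivity)
  have hNpos : 0 < 2 * ℓ ^ m := by have := hℓ.pos; positivity
  have hN0 : NeZero (2 * ℓ ^ m) := ⟨hNpos.ne'⟩
  -- the arithmetic of `ℓ` and `m`
  have hroot' : orderOf ((3 : ℕ) : ZMod (2 * ℓ ^ m)) = Nat.totient (2 * ℓ ^ m) := hroot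
  have hcopN : Nat.Coprime 3 (2 * ℓ ^ m) :=
    coprime_of_orderOf_ne_zero (hroot' ▸ (Nat.totient_pos.2 hNpos).ne')
  have hℓN : ℓ ∣ 2 * ℓ ^ m := (dvd_pow_self ℓ (by omega)).mul_left 2
  have hcop : Nat.Coprime 3 ℓ := hcopN.coprime_dvd_right hℓN
  have hℓ5 : 5 ≤ ℓ := five_le_of_coprime hℓ hℓodd hcop
  have h3ℓ := fun u => exists_pow_eq_unit_of_dvd hℓN hroot' u
  have hℓmN : ℓ ^ m ∣ 2 * ℓ ^ m := Dvd.intro_left 2 rfl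
  have h3ℓm := fun u => exists_pow_eq_unit_of_dvd hℓmN hroot' u
  have htot := totient_two_mul_prime_pow hℓ hℓodd hm
  have hfr : Module.finrank (ZMod 3) F = ℓ ^ (m - 1) * (ℓ - 1) := by
    rw [finrank_eq_of_card hF, htot]
  -- The bound `h ≥ 2`, from `ℓ ≥ 5`, is what gives every `𝔽₃`-functional on `K` a nonzero kernel
  -- vector.
  obtain ⟨h, hh2, hh⟩ : ∃ h, 2 ≤ h ∧ Nat.totient (2 * ℓ ^ m) = 2 * h := by
    obtain ⟨t, rfl⟩ := hℓodd
    refine ⟨(2 * t + 1) ^ (m - 1) * t, ?_, by rw [htot, Nat.add_sub_cancel, mul_left_comm]⟩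
    have := Nat.one_le_pow (m - 1) (2 * t + 1) (by omega)
    nlinarith
  have hdvd := dvd_three_pow_half_add_one hℓ hℓodd (by omega) (hroot.trans hh)
  have hdvd' : 2 * ℓ ^ m ∣ Nat.card F - 1 := by
    rw [hF, hh, mul_comm 2 h, pow_mul]
    have hfac := Nat.sq_sub_sq (3 ^ h) 1
    rw [one_pow] at hfac
    rw [hfac]
    exact hdvd.mul_right _
  -- the subfield and the roots of unity
  set M := (Nat.card F - 1) / (2 * ℓ ^ m) with hMdef
  have hMN : Nat.card F - 1 = 2 * ℓ ^ m * M := (Nat.mul_div_cancel' hdvd').symm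
  obtain ⟨s, hM⟩ := exists_algHom_galoisField (by omega) (hh ▸ hF) hNpos hdvd hMN
  have hcard : Nat.card F = Nat.card (GaloisField 3 h) ^ 2 := by
    rw [GaloisField.card 3 h (by omega), hF, hh, mul_comm, pow_mul]
  have hK : 2 ≤ Module.finrank (ZMod 3) (GaloisField 3 h) := by
    rwa [GaloisField.finrank 3 (by omega)]
  obtain ⟨z, hz⟩ := exists_isPrimitiveRoot hg (hℓmN.trans hdvd')
  have hlift : ∀ y : F, y ^ (2 * ℓ ^ m) = 1 → ∃ a : F, a ≠ 0 ∧ a ^ M = y := fun y hy =>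
    exists_pow_eq_of_pow_eq_one hg hNpos hMN hy
  have hthree : ∀ c : ZMod 3, c ≠ 0 → ∃ a : Fin 3 → F, (∀ i, a i ≠ 0) ∧
      (∀ i j, i ≠ j → a i ^ M ≠ a j ^ M) ∧ ∀ i, Algebra.trace (ZMod 3) F (a i ^ M) = c := by
    intro c hc
    obtain ⟨y, hyinj, hy1, hyc⟩ := exists_three_trace_eq hℓ hm hℓ5 hcop h3ℓ hfr hz hc
    choose a ha0 haM using fun i => hlift (y i) (hy1 i)
    refine ⟨a, ha0, fun i j hij => ?_, fun i => by rw [haM, hyc]⟩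
    rw [haM, haM]
    exact hyinj.ne hij
  have htwo : ¬ ((ℓ : ℤ) ≡ -1 [ZMOD 3] ∧ m = 1 ∧ α = 0) → ∃ a b : F, a ≠ 0 ∧ b ≠ 0 ∧
      a ^ M ≠ b ^ M ∧ Algebra.trace (ZMod 3) F (a ^ M) = α ∧
      Algebra.trace (ZMod 3) F (b ^ M) = α := by
    intro hex
    by_cases hα : α = 0
    · obtain ⟨y, y', hyy, hy, hy', ht, ht'⟩ := exists_two_trace_eq_zero hℓ hm hcop
        (fun hc => hex ⟨hc.1, hc.2, hα⟩) h3ℓm hfr hz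
      obtain ⟨a, ha, rfl⟩ := hlift y hy
      obtain ⟨b, hb, rfl⟩ := hlift y' hy'
      exact ⟨a, b, ha, hb, hyy, ht.trans hα.symm, ht'.trans hα.symm⟩
    · obtain ⟨a, ha, hinj, hc⟩ := hthree α hα
      exact ⟨a 0, a 1, ha 0, ha 1, hinj 0 1 (by decide), hc 0, hc 1⟩
  -- the defining set
  have hd : ∀ i, (d i : F) ≠ 0 ∧
      Algebra.trace (ZMod 3) F ((d i : F) ^ M + β * (d i : F)) = α := fun i => (d i).2
  have hinj : Function.Injective fun i => (d i : F) := fun i j hij => d.injective (Subtype.ext hij)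
  have hex : ∀ x : F, x ≠ 0 → Algebra.trace (ZMod 3) F (x ^ M + β * x) = α →
      ∃ i, (d i : F) = x := fun x hx hxα =>
    ⟨d.symm ⟨x, hx, hxα⟩, by rw [Equiv.apply_symm_apply]⟩
  have hspan : Submodule.span (ZMod 3) (Set.range fun i => (d i : F)) = ⊤ := by
    have hW : ∀ x : F, x ≠ 0 → Algebra.trace (ZMod 3) F (x ^ M + β * x) = α →
        x ∈ Submodule.span (ZMod 3) (Set.range fun i => (d i : F)) := fun x hx hxα =>
      Submodule.subset_span (hex x hx hxα)
    by_cases hβ : β = 0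
    · subst hβ
      obtain ⟨a, b, ha, hb, hab, haα, hbα⟩ :=
        htwo fun hc => hne ⟨hc.1, hc.2.1, hc.2.2, rfl⟩
      exact eq_top_of_eq_zero hcard hM hW ha hb hab haα hbα
    · obtain ⟨c, hc0, hcα⟩ := exists_ne_zero_and_ne α
      obtain ⟨a, ha, hainj, hac⟩ := hthree c hc0
      exact eq_top_of_ne_zero hcard hM hW hβ ha hainj fun i => (hac i).symm ▸ hcα
  refine ⟨?_, ?_, ?_⟩
  · have := finrank_add_finrank_dualCode _ hspan
    omega
  · rintro ⟨hmod, rfl, rfl, hβ, -⟩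
    obtain ⟨a, ha, hainj, hac⟩ := hthree 1 one_ne_zero
    obtain ⟨b, hb, hbα, hbf⟩ : ∃ b : F, b ≠ 0 ∧ Algebra.trace (ZMod 3) F (b ^ M) ≠ 0 ∧
        lineFunctional s β b ≠ 0 := by
      have hne0 : ∀ i, Algebra.trace (ZMod 3) F (a i ^ M) ≠ 0 := fun i => by
        rw [hac]
        exact one_ne_zero
      rcases lineFunctional_ne_zero_or hcard hM hβ (ha 0) (ha 1) (hainj 0 1 (by decide)) with
        hf | hf
      exacts [⟨a 0, ha 0, hne0 0, hf⟩, ⟨a 1, ha 1, hne0 1, hf⟩]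
    obtain ⟨x, hxinj, hxsum, hx⟩ := exists_three_sum_eq_zero hK hM hb hbα hbf
    choose i hi using fun t => hex (x t) (hx t).1 (hx t).2
    have hiinj : Function.Injective i := fun t t' htt => hxinj (by rw [← hi, ← hi, htt])
    refine ⟨3, le_rfl, hasParameters_of_span_eq_top hspan hfr ?_
      (t := Finset.univ.image i) (Finset.univ_nonempty.image i) ?_ ?_⟩
    · refine fun c hc hc0 => three_le_hammingNorm (fun i => (hd i).1) hinj (fun i j hij => ?_)
        hc hc0
      have hi := (hd i).2
      have hj := (hd j).2
      -- `-1` lies in `K^*`, hence `(-1)^M = 1`. If `x` and `-x` were both in `D`, adding the two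
      -- conditions would give `Tr(x^M) = 0`.
      have hneg : (-(d i : F)) ^ M = (d i : F) ^ M := by
        have h1 := hM (-1) (neg_ne_zero.2 one_ne_zero)
        rw [map_neg, map_one] at h1
        rw [neg_pow, h1, one_mul]
      rw [hij, hneg, mul_neg, map_add, map_neg] at hj
      rw [map_add] at hi
      have hpow : ((d i : F) ^ M) ^ (2 * ℓ) = 1 := by
        have : Fintype F := Fintype.ofFinite F
        have hMN' : Nat.card F - 1 = 2 * ℓ * M := by rw [hMN, pow_one]
        rw [← pow_mul, mul_comm, ← hMN', Nat.card_eq_fintype_card]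
        exact FiniteField.pow_card_sub_one_eq_one _ (hd i).1
      refine trace_ne_zero_of_pow_eq_one hℓ hℓodd hcop hmod h3ℓ (by simpa using hfr) hpow ?_
      exact eq_zero_of_add_of_add_neg hi hj
    · rw [Finset.sum_image hiinj.injOn]
      simpa [hi] using hxsum
    · rw [Finset.card_image_of_injective _ hiinj, Finset.card_univ, ZMod.card]
  · intro hnex
    -- Since `J''` is empty for `m = 1`, the condition on `j_β` is vacuous, and `hne` already
    -- excludes `β = 0`.
    have hnot : ¬ ((ℓ : ℤ) ≡ -1 [ZMOD 3] ∧ m = 1 ∧ α = 0) := by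
      rintro ⟨h1, rfl, h3⟩
      refine hnex ⟨h1, rfl, h3, fun hβ => hne ⟨h1, rfl, h3, hβ⟩, ?_⟩
      rw [setJ''_one hℓ.one_le]
      exact Set.notMem_empty _
    obtain ⟨a, -, ha, -, -, haα, -⟩ := htwo hnot
    obtain ⟨x, hx0, hx, hx'⟩ := exists_mem_neg_mem hK hM ha haα β
    obtain ⟨i, hi⟩ := hex x hx0 hx
    obtain ⟨j, hj⟩ := hex (-x) (neg_ne_zero.2 hx0) hx'
    have hij : i ≠ j := by
      rintro rfl
      have h2 : (2 : F) * x = 0 := by linear_combination hi.symm.trans hj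
      have h3 : (3 : F) = 0 := by
        have := charP_of_injective_algebraMap (algebraMap (ZMod 3) F).injective 3
        exact_mod_cast CharP.cast_eq_zero F 3
      exact hx0 (by linear_combination x * h3 - h2)
    refine hasParameters_of_span_eq_top hspan hfr
      (fun c hc hc0 => two_le_hammingNorm (fun i => (hd i).1) hc hc0)
      (t := {i, j}) (by simp) ?_ (Finset.card_pair hij)
    rw [Finset.sum_pair hij, hi, hj, add_neg_cancel]
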